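/- Let $(X,d)$ be a proper, non-compact $\mathrm{CAT}(-1)$ space and $o\in X$. Let $\partial_\infty X$ be its ideal boundary (classes of rays at bounded distance from each other). For $\xi\in\partial_\infty X$ and $p\in X$ let $\beta^p_\xi(z)=\lim_{t\to\infty}\bigl(d(z,c(t))-t\bigr)$, where $c$ is the ray with $c(0)=p$ and $c(\infty)=\xi$. A sequence $x_n\in X$ converges to $\xi$ if it does so in the horofunction compactification of $X$, i.e. if $d(x_n,\cdot)-d(x_n,o)\to\beta^o_\xi$ uniformly on compact sets. Let $G$ be the set of parametrized geodesics (isometric embeddings $g:\mathbb R\to X$) with the topology of uniform convergence on compact sets, and let $g(\pm\infty)$ be the ideal endpoints of $g\in G$. Say that a sequence $(x_n,y_n)$ in $X\times X$ satisfies $(\ast)$ for $g\in G$ if $$x_n\to g(+\infty),\qquad y_n\to g(-\infty),\qquad d(x_n,o)-d(y_n,o)\to\beta^o_{g(-\infty)}(g(0))-\beta^o_{g(+\infty)}(g(0)).$$ Give the disjoint union $X\times X\cup G$ the topology in which $U$ is open if and only if $U\cap(X\times X)$ is open in $X\times X$, $U\cap G$ is open in $G$, and every sequence in $X\times X$ that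 satisfies $(\ast)$ for some $g\in U\cap G$ is eventually in $U$. Then: 1. $X\times X$ is an open subspace and $G$ a closed subspace of $X\times X\cup G$, each with its original topology, and a sequence $(x_n,y_n)$ in $X\times X$ converges to $g\in G$ in $X\times X\cup G$ if and only if it satisfies $(\ast)$ for $g$. 2. Each point of $X\times X$ has a unique nearest point in the diagonal $\Delta=\{(x,x): x\in X\}$ with respect to $d_{\max}((x,y),(x',y'))=\max\{d(x,x'),d(y,y')\}$. Let $\rho:X\times X\to\Delta$ be the nearest-point map. Then its extension $$\tilde\rho: X\times X\cup G\to\Delta,\qquad \tilde\rho|_{X\times X}=\rho,\qquad \tilde\rho(g)=(g(0),g(0))\ \text{ for } g\in G,$$ is continuous. -/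

import Mathlib

open Filter Topology
open scoped NNReal UpperHalfPlane

namespace MaxCompactification

/-- `c` is a geodesic segment from `p` to `q`: it is an isometric embedding of
`[0, dist p q]` (its values elsewhere are irrelevant) with `c 0 = p` and `c (dist p q) = q`. -/
structure IsSegment {X : Type*} [MetricSpace X] (c : ℝ → X) (p q : X) : Prop where
  source : c 0 = p
  target : c (dist p q) = q
  isometric : ∀ s ∈ Set.Icc 0 (dist p q), ∀ t ∈ Set.Icc 0 (dist p q),
    dist (c s) (c t) = |s - t|

/-- `x'` is the point of the segment `p' q'` of the hyperbolic plane at distance `s`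
from `p'`. -/
def IsPointOnSegmentAt (p' q' x' : ℍ) (s : ℝ) : Prop :=
  dist p' x' = s ∧ dist x' q' = dist p' q' - s

/-- `CAT(-1)` spaces: geodesic metric spaces in which every geodesic triangle is at least as
thin as its comparison triangle in the hyperbolic plane (the upper half-plane with its metric of
curvature `-1`). The vertices `p, q, r` are arbitrary, so that `c s` and `c' t` range over the
pairs of points on two different sides of any triangle; for two points on the same side the
comparison is trivial. A comparison triangle always exists and is unique up to isometry. -/
structure IsCATNegOne (X : Type*) [MetricSpace X] : Prop where
  exists_segment : ∀ p q : X, ∃ c : ℝ → X, IsSegment c p q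
  comparison : ∀ (p q r : X) (c c' : ℝ → X), IsSegment c p q → IsSegment c' p r →
    ∃ p' q' r' : ℍ, dist p' q' = dist p q ∧ dist p' r' = dist p r ∧ dist q' r' = dist q r ∧
      ∀ s ∈ Set.Icc 0 (dist p q), ∀ t ∈ Set.Icc 0 (dist p r), ∀ x' y' : ℍ,
        IsPointOnSegmentAt p' q' x' s → IsPointOnSegmentAt p' r' y' t →
          dist (c s) (c' t) ≤ dist x' y'

/-- Rays: isometric embeddings `[0, ∞) → X`. -/
abbrev Ray (X : Type*) [MetricSpace X] : Type _ := {c : ℝ≥0 → X // Isometry c}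

/-- Two rays are asymptotic if they stay at bounded distance from each other. -/
instance raySetoid (X : Type*) [MetricSpace X] : Setoid (Ray X) where
  r c c' := ∃ C : ℝ, ∀ t : ℝ≥0, dist (c.1 t) (c'.1 t) ≤ C
  iseqv :=
    { refl := fun c => ⟨0, fun t => (dist_self (c.1 t)).le⟩
      symm := fun ⟨C, hC⟩ => ⟨C, fun t => (dist_comm _ _).trans_le (hC t)⟩
      trans := fun ⟨C, hC⟩ ⟨C', hC'⟩ =>
        ⟨C + C', fun t => (dist_triangle _ _ _).trans (add_le_add (hC t) (hC' t))⟩ }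

/-- The ideal boundary `∂∞ X`: classes of asymptotic rays. -/
def IdealBoundary (X : Type*) [MetricSpace X] : Type _ := Quotient (raySetoid X)

/-- The point `c(∞)` of the ideal boundary. -/
def Ray.endpoint {X : Type*} [MetricSpace X] (c : Ray X) : IdealBoundary X :=
  Quotient.mk (raySetoid X) c

open Classical in
/-- The Busemann function `β^p_ξ (z) = lim_{t → ∞} dist z (c t) - t`, where `c` is the ray with
`c(0) = p` and `c(∞) = ξ`. In a proper `CAT(-1)` space this ray exists and is unique; the limit
always exists, since `t ↦ dist z (c t) - t` is non-increasing and bounded below. -/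
noncomputable def busemann {X : Type*} [MetricSpace X] (ξ : IdealBoundary X) (p z : X) : ℝ :=
  if h : ∃ c : Ray X, c.1 0 = p ∧ Ray.endpoint c = ξ then
    limUnder atTop (fun t : ℝ≥0 => dist z (h.choose.1 t) - (t : ℝ))
  else 0

/-- Convergence of a sequence `x n` in `X` to the point `ξ` at infinity, in the horofunction
compactification of `X`: the distance functions from `x n`, normalized to vanish at the base
point `o`, converge to `β^o_ξ` uniformly on compact sets. -/
def TendstoBoundary {X : Type*} [MetricSpace X] (o : X) (x : ℕ → X) (ξ : IdealBoundary X) :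
    Prop :=
  ∀ K : Set X, IsCompact K →
    TendstoUniformlyOn (fun n z => dist (x n) z - dist (x n) o) (busemann ξ o) atTop K

/-- The set `G` of parametrized geodesics, i.e. isometric embeddings `ℝ → X`, as a subspace of
`C(ℝ, X)` with the topology of uniform convergence on compact sets. -/
abbrev Geodesic (X : Type*) [MetricSpace X] : Type _ := {g : C(ℝ, X) // Isometry g}

/-- The ray `t ↦ g t`. -/
def Geodesic.posRay {X : Type*} [MetricSpace X] (g : Geodesic X) : Ray X :=
  ⟨fun t => g.1 (t : ℝ), g.2.comp (Isometry.of_dist_eq fun _ _ => rfl)⟩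

/-- The ray `t ↦ g (-t)`. -/
def Geodesic.negRay {X : Type*} [MetricSpace X] (g : Geodesic X) : Ray X :=
  ⟨fun t => g.1 (-(t : ℝ)), g.2.comp (Isometry.of_dist_eq fun s t => dist_neg_neg (s : ℝ) t)⟩

/-- The ideal endpoint `g(+∞)`. -/
def Geodesic.posEnd {X : Type*} [MetricSpace X] (g : Geodesic X) : IdealBoundary X :=
  Ray.endpoint g.posRay

/-- The ideal endpoint `g(-∞)`. -/
def Geodesic.negEnd {X : Type*} [MetricSpace X] (g : Geodesic X) : IdealBoundary X :=
  Ray.endpoint g.negRay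

/-- The prescribed convergence of a sequence `u n = (x n, y n)` in `X × X` to a geodesic `g`. -/
def TendstoGeodesic {X : Type*} [MetricSpace X] (o : X) (u : ℕ → X × X) (g : Geodesic X) :
    Prop :=
  TendstoBoundary o (fun n => (u n).1) g.posEnd ∧
  TendstoBoundary o (fun n => (u n).2) g.negEnd ∧
  Tendsto (fun n => dist (u n).1 o - dist (u n).2 o) atTop
    (𝓝 (busemann g.negEnd o (g.1 0) - busemann g.posEnd o (g.1 0)))

/-- The set `X × X ∪ G` (a disjoint union). -/
inductive Extended (X : Type*) [MetricSpace X] : Type _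
  | pt (p : X × X) : Extended X
  | geod (g : Geodesic X) : Extended X

/-- The topology of `X × X ∪ G`: `U` is open if its traces on `X × X` and on `G` are open and if
every sequence of `X × X` which converges to a geodesic of `U` in the prescribed sense is
eventually in `U`. -/
@[reducible] def extendedTopology {X : Type*} [MetricSpace X] (o : X) : TopologicalSpace (Extended X) where
  IsOpen U := IsOpen (Extended.pt ⁻¹' U) ∧ IsOpen (Extended.geod ⁻¹' U) ∧
    ∀ (u : ℕ → X × X) (g : Geodesic X), Extended.geod g ∈ U → TendstoGeodesic o u g →
      ∀ᶠ n in atTop, Extended.pt (u n) ∈ U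
  isOpen_univ := ⟨isOpen_univ, isOpen_univ, fun _ _ _ _ => Eventually.of_forall fun _ => trivial⟩
  isOpen_inter := fun _ _ hU hV => ⟨hU.1.inter hV.1, hU.2.1.inter hV.2.1, fun u g hg hu =>
    (hU.2.2 u g hg.1 hu).and (hV.2.2 u g hg.2 hu)⟩
  isOpen_sUnion := by
    intro S hS
    refine ⟨?_, ?_, ?_⟩
    · rw [Set.preimage_sUnion]
      exact isOpen_biUnion fun U hU => (hS U hU).1
    · rw [Set.preimage_sUnion]
      exact isOpen_biUnion fun U hU => (hS U hU).2.1
    · rintro u g ⟨U, hU, hg⟩ hu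
      exact ((hS U hU).2.2 u g hg hu).mono fun n hn => ⟨U, hU, hn⟩

/-- `q` is a point of the diagonal `Δ` of `X × X` nearest to `p`. The distance that Mathlib puts
on `X × X` is the maximum distance. -/
def IsNearestPoint {X : Type*} [MetricSpace X] (p : X × X) (q : Set.diagonal X) : Prop :=
  ∀ q' : Set.diagonal X, dist p q.1 ≤ dist p q'.1

/-- The extension of a map `ρ : X × X → Δ` to `X × X ∪ G` by `g ↦ (g 0, g 0)`. -/
def extendRetraction {X : Type*} [MetricSpace X] (ρ : X × X → Set.diagonal X) :
    Extended X → Set.diagonal X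
  | Extended.pt p => ρ p
  | Extended.geod g => ⟨(g.1 0, g.1 0), rfl⟩

end MaxCompactification

/-!
Writing points of the hyperbolic plane in the hyperboloid model turns the comparison axiom into
Stewart's inequality: for a point `c s` of a segment `p q` and any point `z`,
`sinh d(p,q) cosh d(z, c s) ≤ sinh (d(p,q) - s) cosh d(z,p) + sinh s cosh d(z,q)`.

Letting `q` go to infinity along a ray `r` bounds `cosh d(z, c s)` by
`exp (-s) cosh d(z,p) + sinh s exp (β z - β p)`, where `β` is the Busemann function of `r`. Hence
the segments from `p` to `r t` converge to a ray asymptotic to `r`, and `d(z, r s) - s` converges to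
`β z` at a rate that is locally uniform in `r`. Busemann functions therefore depend continuously on
the geodesic, so every condition in the prescribed convergence to `g` is the convergence of a
continuous function on `X × X ∪ G`.

The nearest point to `(x, y)` in the diagonal is given by the midpoint of `x` and `y`, and Stewart's
inequality shows that a midpoint up to an error `ε` is at distance at most `arcosh (exp ε)` from the
midpoint, independently of `d(x, y)`. If `(x n, y n)` converges to `g`, then
`d(x n, g 0) - d(y n, g 0)` tends to `0` by the third condition and the Gromov product of `x n` and
`y n` at `g 0` tends to `0`, so that `g 0` is a midpoint up to an error tending to `0`.
-/

namespace MaxCompactification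

open Real Set

section HyperbolicFunctions

theorem sinh_add_sinh_mul_cosh_add (a s : ℝ) :
    sinh a + sinh s * cosh (a + s) = sinh (a + s) * cosh s := by
  rw [cosh_add, sinh_add]
  linear_combination (-sinh a) * cosh_sq s

theorem sinh_sq_add_sinh_sq_add (a s : ℝ) :
    sinh a ^ 2 + sinh s ^ 2 + 2 * sinh a * sinh s * cosh (a + s) = sinh (a + s) ^ 2 := by
  have hs := sinh_add_sinh_mul_cosh_add a s
  have ha := sinh_add_sinh_mul_cosh_add s a
  rw [add_comm s a] at ha
  linear_combination sinh a * hs + sinh s * ha - sinh (a + s) * sinh_add a s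

theorem sinh_sub_le_exp_neg_mul_sinh (t : ℝ) {s : ℝ} (hs : 0 ≤ s) :
    sinh (t - s) ≤ exp (-s) * sinh t := by
  rw [sinh_sub, ← cosh_sub_sinh]
  nlinarith [sinh_lt_cosh t, sinh_nonneg_iff.2 hs]

theorem cosh_add_le_exp_mul_cosh (t : ℝ) {s : ℝ} (hs : 0 ≤ s) :
    cosh (t + s) ≤ exp s * cosh t := by
  rw [cosh_add, ← cosh_add_sinh]
  nlinarith [sinh_lt_cosh t, sinh_nonneg_iff.2 hs]

theorem exp_sub_le_of_cosh_le {d s a b : ℝ} (h : cosh d ≤ exp (-s) * a + sinh s * b)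
    (hb : 0 ≤ b) : exp (d - s) ≤ 2 * a * exp (-(2 * s)) + b := by
  have hd : exp d ≤ 2 * cosh d := by rw [cosh_eq]; linarith [exp_pos (-d)]
  have hs : 2 * sinh s ≤ exp s := by rw [sinh_eq]; linarith [exp_pos (-s)]
  calc exp (d - s) = exp d * exp (-s) := by rw [sub_eq_add_neg, exp_add]
    _ ≤ (2 * exp (-s) * a + exp s * b) * exp (-s) := by
      gcongr
      linarith [mul_le_mul_of_nonneg_right hs hb]
    _ = 2 * a * (exp (-s) * exp (-s)) + exp s * exp (-s) * b := by ring
    _ = 2 * a * exp (-(2 * s)) + b := by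
      rw [← exp_add, ← exp_add, add_neg_cancel, exp_zero, one_mul, ← neg_add, ← two_mul]

variable {ι : Type*} {l : Filter ι} {E L : ι → ℝ} {β : ℝ}

theorem tendsto_cosh_mul_exp_neg (hL : Tendsto L l atTop)
    (hE : Tendsto (fun i => E i - L i) l (𝓝 β)) :
    Tendsto (fun i => cosh (E i) * exp (-L i)) l (𝓝 (exp β / 2)) := by
  have hexp := tendsto_exp_neg_atTop_nhds_zero.comp hL
  have hlim := (((continuous_exp.tendsto _).comp hE).add
    (((continuous_exp.tendsto _).comp hE.neg).mul (hexp.mul hexp))).div_const 2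
  rw [mul_zero, mul_zero, add_zero] at hlim
  refine hlim.congr fun i => ?_
  simp only [Function.comp_apply]
  rw [cosh_eq, ← exp_add, ← exp_add, div_mul_eq_mul_div, add_mul, ← exp_add, ← exp_add]
  ring_nf

theorem tendsto_sinh_mul_exp_neg (hL : Tendsto L l atTop) :
    Tendsto (fun i => sinh (L i) * exp (-L i)) l (𝓝 (1 / 2)) := by
  have hexp := tendsto_exp_neg_atTop_nhds_zero.comp hL
  have hlim := ((hexp.mul hexp).const_sub 1).div_const 2
  rw [mul_zero, sub_zero] at hlim
  refine hlim.congr fun i => ?_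
  simp only [Function.comp_apply]
  rw [sinh_eq, div_mul_eq_mul_div, sub_mul, ← exp_add (L i), add_neg_cancel, exp_zero]

theorem tendsto_cosh_div_sinh (hL : Tendsto L l atTop)
    (hE : Tendsto (fun i => E i - L i) l (𝓝 β)) :
    Tendsto (fun i => cosh (E i) / sinh (L i)) l (𝓝 (exp β)) := by
  have hlim := (tendsto_cosh_mul_exp_neg hL hE).div (tendsto_sinh_mul_exp_neg hL) (by norm_num)
  rw [div_div_div_cancel_right₀ two_ne_zero, div_one] at hlim
  exact hlim.congr fun i => mul_div_mul_right _ _ (exp_pos _).ne'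

theorem tendsto_const_mul_exp_neg_two_mul (a : ℝ) :
    Tendsto (fun s : ℝ≥0 => a * exp (-(2 * s))) atTop (𝓝 0) := by
  have h := tendsto_exp_neg_atTop_nhds_zero.comp
    ((NNReal.tendsto_coe_atTop.2 tendsto_id).const_mul_atTop (zero_lt_two (α := ℝ)))
  simpa only [mul_zero, Function.comp_def, id] using h.const_mul a

end HyperbolicFunctions

section HyperbolicPlane

/-- In the hyperboloid model, `x` is the point `(α p + β q) / γ`. -/
theorem exists_mul_cosh_dist_eq (p q : ℍ) {α β γ : ℝ} (hα : 0 ≤ α) (hβ : 0 ≤ β) (hγ : 0 < γ)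
    (h : α ^ 2 + β ^ 2 + 2 * α * β * cosh (dist p q) = γ ^ 2) :
    ∃ x : ℍ, ∀ z : ℍ,
      γ * cosh (dist z x) = α * cosh (dist z p) + β * cosh (dist z q) := by
  have _hp := p.im_pos
  have _hq := q.im_pos
  -- A point `z` of `ℍ` has the hyperboloid coordinates `1 / im z`, `re z / im z`, `|z| ^ 2 / im z`.
  set u := α / p.im + β / q.im with hu
  set v := α * p.re / p.im + β * q.re / q.im with hv
  set w := α * (p.re ^ 2 + p.im ^ 2) / p.im + β * (q.re ^ 2 + q.im ^ 2) / q.im with hw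
  have hu_pos : 0 < u := by
    rcases hα.eq_or_lt with rfl | hα_pos
    · have hβ_pos : 0 < β := hβ.lt_of_ne' fun hβ_zero =>
        (pow_pos hγ 2).ne (by simpa [hβ_zero] using h)
      positivity
    · positivity
  have huvw : u * w - v ^ 2 = γ ^ 2 := by
    rw [← h, UpperHalfPlane.cosh_dist', hu, hv, hw]
    field_simp
    ring
  let x : ℍ := ⟨⟨v / u, γ / u⟩, div_pos hγ hu_pos⟩
  have hx_re : x.re = v / u := rfl
  have hx_im : x.im = γ / u := rfl
  refine ⟨x, fun z => ?_⟩
  have _hz := z.im_pos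
  calc γ * cosh (dist z x)
      = (u * (z.re ^ 2 + z.im ^ 2) - 2 * z.re * v + w) / (2 * z.im) := by
        rw [UpperHalfPlane.cosh_dist', hx_re, hx_im]
        field_simp
        linear_combination (-1) * huvw
    _ = α * cosh (dist z p) + β * cosh (dist z q) := by
        rw [UpperHalfPlane.cosh_dist', UpperHalfPlane.cosh_dist', hu, hv, hw]
        field_simp
        ring

theorem exists_isPointOnSegmentAt (p q : ℍ) {s : ℝ} (hpq : 0 < dist p q)
    (hs : s ∈ Icc 0 (dist p q)) :
    ∃ x : ℍ, IsPointOnSegmentAt p q x s ∧ ∀ z : ℍ, sinh (dist p q) * cosh (dist z x) =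
      sinh (dist p q - s) * cosh (dist z p) + sinh s * cosh (dist z q) := by
  obtain ⟨a, ha⟩ : ∃ a, a = dist p q - s := ⟨_, rfl⟩
  have hdist : dist p q = a + s := by linarith
  have ha_nonneg : 0 ≤ a := by linarith [hs.2]
  have hsinh_pos : 0 < sinh (a + s) := sinh_pos_iff.2 (hdist ▸ hpq)
  obtain ⟨x, hx⟩ := exists_mul_cosh_dist_eq p q (sinh_nonneg_iff.2 ha_nonneg)
    (sinh_nonneg_iff.2 hs.1) hsinh_pos (by rw [hdist, sinh_sq_add_sinh_sq_add])
  refine ⟨x, ⟨?_, ?_⟩, fun z => by rw [← ha, hdist, hx]⟩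
  · refine cosh_injOn (mem_Ici.2 dist_nonneg) (mem_Ici.2 hs.1)
      (mul_left_cancel₀ hsinh_pos.ne' ?_)
    rw [hx, dist_self, cosh_zero, mul_one, hdist, sinh_add_sinh_mul_cosh_add]
  · rw [← ha]
    refine cosh_injOn (mem_Ici.2 dist_nonneg) (mem_Ici.2 ha_nonneg)
      (mul_left_cancel₀ hsinh_pos.ne' ?_)
    rw [dist_comm, hx, dist_self, cosh_zero, mul_one, dist_comm q p, hdist, add_comm (_ * _),
      add_comm a s, sinh_add_sinh_mul_cosh_add]

end HyperbolicPlane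

variable {X : Type*} [MetricSpace X]

theorem eq_of_cosh_dist_le_one {x y : X} (h : cosh (dist x y) ≤ 1) : x = y := by
  by_contra hxy
  exact h.not_gt (one_lt_cosh.2 (dist_ne_zero.2 hxy))

theorem dist_lt_of_cosh_dist_lt_cosh {x y : X} {ε : ℝ} (hε : 0 ≤ ε)
    (h : cosh (dist x y) < cosh ε) : dist x y < ε :=
  (cosh_strictMonoOn.lt_iff_lt (mem_Ici.2 dist_nonneg) (mem_Ici.2 hε)).1 h

theorem cosh_dist_le_cosh {x y : X} {a : ℝ} (h : dist x y ≤ a) : cosh (dist x y) ≤ cosh a :=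
  cosh_strictMonoOn.monotoneOn (mem_Ici.2 dist_nonneg) (mem_Ici.2 (dist_nonneg.trans h)) h

theorem tendsto_dist_sub_dist_zero {ι : Type*} {l : Filter ι} {w : ι → X} {z : X}
    (hw : Tendsto w l (𝓝 z)) (x : ι → X) :
    Tendsto (fun i => dist (w i) (x i) - dist z (x i)) l (𝓝 0) :=
  squeeze_zero_norm (fun i => abs_dist_sub_le (w i) z (x i)) (tendsto_iff_dist_tendsto_zero.1 hw)

section Segments

variable {p q : X} {c : ℝ → X} {s : ℝ}

theorem IsSegment.dist_source (hc : IsSegment c p q) (hs : s ∈ Icc 0 (dist p q)) :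
    dist p (c s) = s := by
  have h := hc.isometric 0 ⟨le_rfl, dist_nonneg⟩ s hs
  rwa [hc.source, zero_sub, abs_neg, abs_of_nonneg hs.1] at h

theorem IsSegment.dist_target (hc : IsSegment c p q) (hs : s ∈ Icc 0 (dist p q)) :
    dist (c s) q = dist p q - s := by
  have h := hc.isometric s hs (dist p q) ⟨dist_nonneg, le_rfl⟩
  rwa [hc.target, abs_sub_comm, abs_of_nonneg (sub_nonneg.2 hs.2)] at h

/-- Stewart's theorem of hyperbolic geometry, which becomes an inequality in a `CAT(-1)` space. -/
theorem IsCATNegOne.stewart (hX : IsCATNegOne X) (hc : IsSegment c p q) (z : X)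
    (hs : s ∈ Icc 0 (dist p q)) :
    sinh (dist p q) * cosh (dist z (c s)) ≤
      sinh (dist p q - s) * cosh (dist z p) + sinh s * cosh (dist z q) := by
  rcases (dist_nonneg (x := p) (y := q)).eq_or_lt with hpq_zero | hpq_pos
  · have hs_zero : s = 0 := le_antisymm (hpq_zero ▸ hs.2) hs.1
    simp [← hpq_zero, hs_zero]
  obtain ⟨c', hc'⟩ := hX.exists_segment p z
  obtain ⟨p', q', z', hpq, hpz, hqz, hcomp⟩ := hX.comparison p q z c c' hc hc'
  obtain ⟨x', hx', hstewart⟩ := exists_isPointOnSegmentAt p' q' (hpq ▸ hpq_pos) (hpq.symm ▸ hs)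
  have hle : dist z (c s) ≤ dist z' x' := by
    have h := hcomp s hs (dist p z) ⟨dist_nonneg, le_rfl⟩ x' z' hx'
      ⟨hpz, by rw [dist_self, hpz, sub_self]⟩
    rwa [hc'.target, dist_comm, dist_comm x'] at h
  calc sinh (dist p q) * cosh (dist z (c s))
      ≤ sinh (dist p q) * cosh (dist z' x') :=
        mul_le_mul_of_nonneg_left (cosh_dist_le_cosh hle) (sinh_nonneg_iff.2 hpq_pos.le)
    _ = sinh (dist p q - s) * cosh (dist z p) + sinh s * cosh (dist z q) := by
        rw [← hpq, hstewart, hpq, dist_comm z' p', hpz, dist_comm z' q', hqz, dist_comm z p,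
          dist_comm z q]

theorem IsCATNegOne.cosh_dist_le (hX : IsCATNegOne X) (hc : IsSegment c p q) (z : X)
    (hs : s ∈ Icc 0 (dist p q)) (hpq : 0 < dist p q) :
    cosh (dist z (c s)) ≤
      exp (-s) * cosh (dist z p) + sinh s * (cosh (dist z q) / sinh (dist p q)) := by
  have hsinh : 0 < sinh (dist p q) := sinh_pos_iff.2 hpq
  refine le_of_mul_le_mul_left ((hX.stewart hc z hs).trans ?_) hsinh
  calc sinh (dist p q - s) * cosh (dist z p) + sinh s * cosh (dist z q)
      ≤ exp (-s) * sinh (dist p q) * cosh (dist z p) + sinh s * cosh (dist z q) := by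
        gcongr
        exact sinh_sub_le_exp_neg_mul_sinh _ hs.1
    _ = sinh (dist p q) *
          (exp (-s) * cosh (dist z p) + sinh s * (cosh (dist z q) / sinh (dist p q))) := by
        field_simp

theorem IsCATNegOne.cosh_dist_midpoint_le (hX : IsCATNegOne X) (hc : IsSegment c p q) (z : X) :
    2 * cosh (dist p q / 2) * cosh (dist z (c (dist p q / 2))) ≤
      cosh (dist z p) + cosh (dist z q) := by
  rcases (dist_nonneg (x := p) (y := q)).eq_or_lt with hpq_zero | hpq_pos
  · rw [← hpq_zero, zero_div, hc.source, ← dist_eq_zero.1 hpq_zero.symm, cosh_zero]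
    linarith
  · have hstewart := hX.stewart hc z (s := dist p q / 2) ⟨by linarith, by linarith⟩
    have hsinh : sinh (dist p q) = 2 * sinh (dist p q / 2) * cosh (dist p q / 2) := by
      rw [← sinh_two_mul, mul_div_cancel₀ _ two_ne_zero]
    rw [sub_half, hsinh] at hstewart
    refine le_of_mul_le_mul_left ?_ (sinh_pos_iff.2 (half_pos hpq_pos))
    linarith

theorem IsCATNegOne.sinh_sq_mul_cosh_dist_sub_one_le (hX : IsCATNegOne X) {q' : X} {c' : ℝ → X}
    (hc : IsSegment c p q) (hc' : IsSegment c' p q') (hqq' : dist p q = dist p q')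
    (hs : s ∈ Icc 0 (dist p q)) :
    sinh (dist p q) ^ 2 * (cosh (dist (c s) (c' s)) - 1) ≤
      sinh s ^ 2 * (cosh (dist q q') - 1) := by
  have hs' : s ∈ Icc 0 (dist p q') := hqq' ▸ hs
  have hcs := hX.stewart hc (c' s) hs
  have hq := hX.stewart hc' q hs'
  rw [dist_comm (c' s) p, hc'.dist_source hs', dist_comm (c' s) (c s),
    dist_comm (c' s) q] at hcs
  rw [dist_comm q p, ← hqq'] at hq
  set T := dist p q
  have hidentity : sinh T * (sinh (T - s) * cosh s) + sinh s * (sinh (T - s) * cosh T) =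
      sinh T ^ 2 - sinh s ^ 2 := by
    rw [sinh_sub]
    linear_combination sinh T ^ 2 * cosh_sq s - sinh s ^ 2 * cosh_sq T
  have hcs_mul := mul_le_mul_of_nonneg_left hcs (sinh_nonneg_iff.2 (hs.1.trans hs.2))
  have hq_mul := mul_le_mul_of_nonneg_left hq (sinh_nonneg_iff.2 hs.1)
  linarith

end Segments

section SegmentsToInfinity

variable {ι : Type*} {l : Filter ι} {p z : X} {q : ι → X} {c : ι → ℝ → X} {s β : ℝ}

theorem IsCATNegOne.eventually_cosh_dist_lt (hX : IsCATNegOne X)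
    (hc : ∀ i, IsSegment (c i) p (q i)) (hq : Tendsto (fun i => dist p (q i)) l atTop)
    (hz : Tendsto (fun i => dist z (q i) - dist p (q i)) l (𝓝 β)) (hs : 0 ≤ s) {b : ℝ}
    (hb : exp (-s) * cosh (dist z p) + sinh s * exp β < b) :
    ∀ᶠ i in l, cosh (dist z (c i s)) < b := by
  have hbound := ((tendsto_cosh_div_sinh hq hz).const_mul (sinh s)).const_add
    (exp (-s) * cosh (dist z p))
  filter_upwards [hbound.eventually_lt_const hb, hq.eventually_gt_atTop s] with i hlt hi
  exact (hX.cosh_dist_le (hc i) z ⟨hs, hi.le⟩ (hs.trans_lt hi)).trans_lt hlt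

theorem IsCATNegOne.tendsto_segment_apply (hX : IsCATNegOne X)
    (hc : ∀ i, IsSegment (c i) p (q i)) (hq : Tendsto (fun i => dist p (q i)) l atTop)
    (hs : dist z p = s) (hz : Tendsto (fun i => dist z (q i) - dist p (q i)) l (𝓝 (-s))) :
    Tendsto (fun i => c i s) l (𝓝 z) := by
  subst hs
  refine Metric.tendsto_nhds.2 fun ε hε => ?_
  have hbound : exp (-dist z p) * cosh (dist z p) + sinh (dist z p) * exp (-dist z p) < cosh ε := by
    rw [mul_comm (sinh _), ← mul_add, cosh_add_sinh, ← exp_add, neg_add_cancel, exp_zero]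
    exact one_lt_cosh.2 hε.ne'
  filter_upwards [hX.eventually_cosh_dist_lt hc hq hz dist_nonneg hbound] with i hi
  rw [dist_comm]
  exact dist_lt_of_cosh_dist_lt_cosh hε.le hi

end SegmentsToInfinity

section GromovProduct

/-- The Gromov product `(x | y)_p`. -/
noncomputable def gromovProduct (p x y : X) : ℝ :=
  (dist x p + dist y p - dist x y) / 2

theorem gromovProduct_nonneg (p x y : X) : 0 ≤ gromovProduct p x y :=
  div_nonneg (sub_nonneg.2 (dist_triangle_right x y p)) zero_le_two

theorem exp_neg_two_mul_gromovProduct (p x y : X) :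
    exp (-(2 * gromovProduct p x y)) = exp (dist x y) * (exp (-dist x p) * exp (-dist p y)) := by
  rw [← exp_add, ← exp_add, gromovProduct, dist_comm y p]
  ring_nf

theorem IsCATNegOne.le_exp_neg_gromovProduct (hX : IsCATNegOne X) {p y : X} {c : ℝ → X} {s : ℝ}
    (hc : IsSegment c p y) (x : X) (hs : s ∈ Icc 0 (dist p y)) :
    2 * (sinh (dist p y) * exp (-dist p y)) * (cosh (dist x (c s)) * exp (-dist x p) -
        exp (-s) * (cosh (dist x p) * exp (-dist x p))) ≤
      sinh s * (exp (-(2 * gromovProduct p x y)) + exp (-dist x p) * exp (-dist p y)) := by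
  set P := exp (-dist x p) * exp (-dist p y)
  have hcosh : 2 * cosh (dist x y) ≤ exp (dist x y) + 1 := by
    rw [cosh_eq]
    linarith [exp_le_one_iff.2 (neg_nonpos.2 (dist_nonneg (x := x) (y := y)))]
  have hstewart : 2 * sinh (dist p y) * (cosh (dist x (c s)) - exp (-s) * cosh (dist x p)) ≤
      sinh s * (exp (dist x y) + 1) := by
    have hsub := mul_le_mul_of_nonneg_right (sinh_sub_le_exp_neg_mul_sinh (dist p y) hs.1)
      (cosh_pos (dist x p)).le
    have hright := mul_le_mul_of_nonneg_left hcosh (sinh_nonneg_iff.2 hs.1)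
    linarith [hX.stewart hc x hs]
  calc _ = 2 * sinh (dist p y) * (cosh (dist x (c s)) - exp (-s) * cosh (dist x p)) * P := by ring
    _ ≤ sinh s * (exp (dist x y) + 1) * P := by gcongr
    _ = sinh s * (exp (-(2 * gromovProduct p x y)) + P) := by
      rw [exp_neg_two_mul_gromovProduct]
      ring

/-- The hypothesis `hxc` says that, asymptotically, the segments from `p` to `y i` leave `p` in the
direction opposite to `x i`. -/
theorem IsCATNegOne.tendsto_gromovProduct_zero (hX : IsCATNegOne X) {ι : Type*} {l : Filter ι}
    {p : X} {x y : ι → X} {c : ι → ℝ → X} {s : ℝ} (hs : 0 < s)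
    (hc : ∀ i, IsSegment (c i) p (y i)) (hx : Tendsto (fun i => dist (x i) p) l atTop)
    (hy : Tendsto (fun i => dist p (y i)) l atTop)
    (hxc : Tendsto (fun i => dist (x i) (c i s) - dist (x i) p) l (𝓝 s)) :
    Tendsto (fun i => gromovProduct p (x i) (y i)) l (𝓝 0) := by
  have hsinh : 0 < sinh s := sinh_pos_iff.2 hs
  have hxx : Tendsto (fun i => dist (x i) p - dist (x i) p) l (𝓝 0) :=
    tendsto_const_nhds.congr fun i => (sub_self _).symm
  have hlower := ((((tendsto_sinh_mul_exp_neg hy).const_mul 2).mul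
    ((tendsto_cosh_mul_exp_neg hx hxc).sub
      ((tendsto_cosh_mul_exp_neg hx hxx).const_mul (exp (-s))))).div_const (sinh s)).sub
    ((tendsto_exp_neg_atTop_nhds_zero.comp hx).mul (tendsto_exp_neg_atTop_nhds_zero.comp hy))
  have hlimit : 2 * (1 / 2) * (exp s / 2 - exp (-s) * (exp 0 / 2)) / sinh s - 0 * 0 = 1 := by
    rw [sub_eq_iff_eq_add, div_eq_iff hsinh.ne', exp_zero, sinh_eq]
    ring
  rw [hlimit] at hlower
  have hexp : Tendsto (fun i => exp (-(2 * gromovProduct p (x i) (y i)))) l (𝓝 1) := by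
    refine tendsto_of_tendsto_of_tendsto_of_le_of_le' hlower tendsto_const_nhds ?_ ?_
    · filter_upwards [hy.eventually_ge_atTop s] with i hi
      exact sub_le_iff_le_add.2
        ((div_le_iff₀' hsinh).2 (hX.le_exp_neg_gromovProduct (hc i) (x i) ⟨hs.le, hi⟩))
    · exact Eventually.of_forall fun i => exp_le_one_iff.2
        (neg_nonpos.2 (mul_nonneg zero_le_two (gromovProduct_nonneg _ _ _)))
  have hlog := (hexp.log one_ne_zero).div_const (-2)
  rw [log_one, zero_div] at hlog
  exact hlog.congr fun i => by rw [log_exp]; ring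

end GromovProduct

section Midpoints

/-- `z` is a midpoint of the points `p.1` and `p.2` up to an error `ε`; for `ε = 0` these are the
midpoints. -/
def IsApproxMidpoint (ε : ℝ) (p : X × X) (z : X) : Prop :=
  dist p.1 z ≤ dist p.1 p.2 / 2 + ε ∧ dist p.2 z ≤ dist p.1 p.2 / 2 + ε

variable {p : X × X} {m z : X} {ε : ℝ}

theorem IsApproxMidpoint.nonneg (hz : IsApproxMidpoint ε p z) : 0 ≤ ε := by
  linarith [hz.1, hz.2, dist_triangle_right p.1 p.2 z]

theorem IsApproxMidpoint.of_dist_le {p' : X × X} {δ : ℝ} (hz : IsApproxMidpoint ε p z)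
    (hδ : dist p' p ≤ δ) : IsApproxMidpoint (ε + 2 * δ) p' z := by
  have h₁ : dist p'.1 p.1 ≤ δ := (le_max_left _ _).trans hδ
  have h₂ : dist p'.2 p.2 ≤ δ := (le_max_right _ _).trans hδ
  have hpp' := dist_triangle4 p.1 p'.1 p'.2 p.2
  rw [dist_comm p.1 p'.1] at hpp'
  constructor
  · linarith [hz.1, dist_triangle p'.1 p.1 z]
  · linarith [hz.2, dist_triangle p'.2 p.2 z]

theorem isApproxMidpoint_gromovProduct (p : X × X) (z : X) :
    IsApproxMidpoint (|dist p.1 z - dist p.2 z| / 2 + gromovProduct z p.1 p.2) p z := by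
  unfold IsApproxMidpoint gromovProduct
  constructor
  · linarith [le_abs_self (dist p.1 z - dist p.2 z)]
  · linarith [neg_abs_le (dist p.1 z - dist p.2 z)]

theorem IsCATNegOne.exists_isApproxMidpoint_zero (hX : IsCATNegOne X) (p : X × X) :
    ∃ m, IsApproxMidpoint 0 p m := by
  obtain ⟨c, hc⟩ := hX.exists_segment p.1 p.2
  have hmem : dist p.1 p.2 / 2 ∈ Icc 0 (dist p.1 p.2) :=
    ⟨div_nonneg dist_nonneg zero_le_two, half_le_self dist_nonneg⟩
  refine ⟨c (dist p.1 p.2 / 2), ?_, ?_⟩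
  · rw [hc.dist_source hmem, add_zero]
  · rw [dist_comm, hc.dist_target hmem, sub_half, add_zero]

theorem IsCATNegOne.cosh_dist_segment_le_exp (hX : IsCATNegOne X) {c : ℝ → X}
    (hc : IsSegment c p.1 p.2) (hz : IsApproxMidpoint ε p z) :
    cosh (dist z (c (dist p.1 p.2 / 2))) ≤ exp ε := by
  have h₁ := (cosh_dist_le_cosh hz.1).trans (cosh_add_le_exp_mul_cosh _ hz.nonneg)
  have h₂ := (cosh_dist_le_cosh hz.2).trans (cosh_add_le_exp_mul_cosh _ hz.nonneg)
  have hmid := hX.cosh_dist_midpoint_le hc z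
  rw [dist_comm z p.1, dist_comm z p.2] at hmid
  refine le_of_mul_le_mul_left ?_ (cosh_pos (dist p.1 p.2 / 2))
  linarith

theorem IsCATNegOne.cosh_dist_le_exp (hX : IsCATNegOne X) (hm : IsApproxMidpoint 0 p m)
    (hz : IsApproxMidpoint ε p z) : cosh (dist z m) ≤ exp ε := by
  obtain ⟨c, hc⟩ := hX.exists_segment p.1 p.2
  rw [eq_of_cosh_dist_le_one ((hX.cosh_dist_segment_le_exp hc hm).trans_eq exp_zero)]
  exact hX.cosh_dist_segment_le_exp hc hz

theorem IsCATNegOne.eq_of_isApproxMidpoint_zero (hX : IsCATNegOne X)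
    (hm : IsApproxMidpoint 0 p m) (hz : IsApproxMidpoint 0 p z) : z = m :=
  eq_of_cosh_dist_le_one ((hX.cosh_dist_le_exp hm hz).trans_eq exp_zero)

theorem IsCATNegOne.tendsto_midpoint (hX : IsCATNegOne X) {ι : Type*} {l : Filter ι}
    {p : ι → X × X} {m : ι → X} {ε : ι → ℝ} (hm : ∀ i, IsApproxMidpoint 0 (p i) (m i))
    (hz : ∀ i, IsApproxMidpoint (ε i) (p i) z) (hε : Tendsto ε l (𝓝 0)) :
    Tendsto m l (𝓝 z) := by
  refine Metric.tendsto_nhds.2 fun δ hδ => ?_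
  have hexp := (continuous_exp.tendsto _).comp hε
  rw [exp_zero] at hexp
  filter_upwards [hexp.eventually_lt_const (one_lt_cosh.2 hδ.ne')] with i hi
  rw [dist_comm]
  exact dist_lt_of_cosh_dist_lt_cosh hδ.le ((hX.cosh_dist_le_exp (hm i) (hz i)).trans_lt hi)

theorem IsCATNegOne.continuous_midpoint (hX : IsCATNegOne X) {m : X × X → X}
    (hm : ∀ p, IsApproxMidpoint 0 p (m p)) : Continuous m := by
  refine continuous_iff_continuousAt.2 fun p => ?_
  refine hX.tendsto_midpoint hm (fun p' => (hm p).of_dist_le le_rfl) ?_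
  have hcont : Continuous fun p' => 0 + 2 * dist p' p := by fun_prop
  simpa only [dist_self, mul_zero, add_zero] using hcont.tendsto p

theorem IsCATNegOne.isNearestPoint_iff (hX : IsCATNegOne X) (p : X × X) (q : diagonal X) :
    IsNearestPoint p q ↔ IsApproxMidpoint 0 p q.1.1 := by
  have hdist : ∀ r : diagonal X, dist p r.1 = max (dist p.1 r.1.1) (dist p.2 r.1.1) := by
    rintro ⟨⟨a, b⟩, hab⟩
    obtain rfl : a = b := hab
    rfl
  constructor
  · intro hq
    obtain ⟨m, hm⟩ := hX.exists_isApproxMidpoint_zero p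
    have hle := hq ⟨(m, m), rfl⟩
    rw [hdist, hdist] at hle
    exact max_le_iff.1 (hle.trans (max_le hm.1 hm.2))
  · intro hq r
    rw [hdist, hdist]
    refine (max_le hq.1 hq.2).trans ?_
    linarith [dist_triangle_right p.1 p.2 r.1.1, le_max_left (dist p.1 r.1.1) (dist p.2 r.1.1),
      le_max_right (dist p.1 r.1.1) (dist p.2 r.1.1)]

theorem IsCATNegOne.existsUnique_isNearestPoint (hX : IsCATNegOne X) (p : X × X) :
    ∃! q : diagonal X, IsNearestPoint p q := by
  obtain ⟨m, hm⟩ := hX.exists_isApproxMidpoint_zero p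
  refine ⟨⟨(m, m), rfl⟩, (hX.isNearestPoint_iff p _).2 hm, ?_⟩
  rintro ⟨⟨a, b⟩, hab⟩ hq
  obtain rfl : a = b := hab
  obtain rfl := hX.eq_of_isApproxMidpoint_zero hm ((hX.isNearestPoint_iff p _).1 hq)
  rfl

end Midpoints

section Rays

variable (r : Ray X) (z w : X) (s : ℝ≥0)

theorem Ray.dist_eq (t : ℝ≥0) : dist (r.1 s) (r.1 t) = |(s : ℝ) - t| := by
  rw [r.2.dist_eq, NNReal.dist_eq]

theorem Ray.dist_zero : dist (r.1 0) (r.1 s) = s := by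
  rw [r.dist_eq, NNReal.coe_zero, zero_sub, abs_neg, NNReal.abs_eq]

theorem Ray.isSegment : IsSegment (fun t => r.1 t.toNNReal) (r.1 0) (r.1 s) where
  source := by rw [toNNReal_zero]
  target := by rw [r.dist_zero, toNNReal_coe]
  isometric a ha b hb := by rw [r.dist_eq, coe_toNNReal _ ha.1, coe_toNNReal _ hb.1]

/-- The Busemann function `z ↦ lim dist z (r t) - t` of the ray `r`. -/
noncomputable def Ray.busemann : ℝ :=
  limUnder atTop fun t : ℝ≥0 => dist z (r.1 t) - (t : ℝ)

theorem Ray.tendsto_busemann :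
    Tendsto (fun t : ℝ≥0 => dist z (r.1 t) - (t : ℝ)) atTop (𝓝 (r.busemann z)) := by
  refine tendsto_nhds_limUnder ⟨_, tendsto_atTop_ciInf ?_ ⟨-dist z (r.1 0), ?_⟩⟩
  · intro a b hab
    have htriangle := dist_triangle z (r.1 a) (r.1 b)
    rw [r.dist_eq, abs_sub_comm, abs_of_nonneg (sub_nonneg.2 (NNReal.coe_le_coe.2 hab))]
      at htriangle
    simp only
    linarith
  · rintro _ ⟨t, rfl⟩
    have htriangle := dist_triangle_left (r.1 0) (r.1 t) z
    rw [r.dist_zero] at htriangle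
    simp only
    linarith

theorem Ray.busemann_le_dist_add : r.busemann z ≤ dist z w + r.busemann w := by
  refine le_of_tendsto_of_tendsto' (r.tendsto_busemann z)
    ((r.tendsto_busemann w).const_add (dist z w)) fun t => ?_
  linarith [dist_triangle z w (r.1 t)]

theorem Ray.busemann_apply : r.busemann (r.1 s) = -s := by
  refine tendsto_nhds_unique (r.tendsto_busemann _) (tendsto_const_nhds.congr' ?_)
  filter_upwards [eventually_ge_atTop s] with t ht
  rw [r.dist_eq, abs_sub_comm, abs_of_nonneg (sub_nonneg.2 (NNReal.coe_le_coe.2 ht))]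
  ring

theorem Ray.busemann_le : r.busemann z ≤ dist z (r.1 s) - s := by
  have hle := r.busemann_le_dist_add z (r.1 s)
  rwa [r.busemann_apply, ← sub_eq_add_neg] at hle

theorem Ray.tendsto_dist_sub_dist :
    Tendsto (fun t => dist z (r.1 t) - dist w (r.1 t)) atTop
      (𝓝 (r.busemann z - r.busemann w)) :=
  ((r.tendsto_busemann z).sub (r.tendsto_busemann w)).congr fun _ => sub_sub_sub_cancel_right ..

theorem Ray.tendsto_dist_atTop : Tendsto (fun t => dist z (r.1 t)) atTop atTop :=
  ((r.tendsto_busemann z).add_atTop (NNReal.tendsto_coe_atTop.2 tendsto_id)).congr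
    fun _ => sub_add_cancel ..

end Rays

section CoRays

/-- `c` is a co-ray of `r`: a limit of segments from the origin of `c` to the points `r t` as
`t → ∞`. -/
def Ray.IsCoRay (c r : Ray X) : Prop :=
  ∃ σ : ℝ≥0 → ℝ → X, (∀ t, IsSegment (σ t) (c.1 0) (r.1 t)) ∧
    ∀ s : ℝ≥0, Tendsto (fun t => σ t s) atTop (𝓝 (c.1 s))

theorem Ray.isCoRay_self (r : Ray X) : r.IsCoRay r :=
  ⟨_, r.isSegment, fun s => by
    simp only [toNNReal_coe]
    exact tendsto_const_nhds⟩

variable {c r : Ray X}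

theorem Ray.IsCoRay.busemann_apply (hcr : c.IsCoRay r) (s : ℝ≥0) :
    r.busemann (c.1 s) = r.busemann (c.1 0) - s := by
  obtain ⟨σ, hσ, hlim⟩ := hcr
  have hsegment : Tendsto (fun t => dist (σ t s) (r.1 t) - t) atTop
      (𝓝 (r.busemann (c.1 0) - s)) := by
    refine ((r.tendsto_busemann (c.1 0)).sub_const (s : ℝ)).congr' ?_
    filter_upwards [(r.tendsto_dist_atTop (c.1 0)).eventually_ge_atTop (s : ℝ)] with t ht
    rw [(hσ t).dist_target ⟨s.coe_nonneg, ht⟩]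
    ring
  refine tendsto_nhds_unique (r.tendsto_busemann (c.1 s)) ?_
  have hclose := (tendsto_dist_sub_dist_zero (hlim s) r.1).neg
  simpa only [neg_zero, neg_sub, zero_add, sub_add_sub_cancel] using hclose.add hsegment

theorem IsCATNegOne.cosh_dist_coRay_le (hX : IsCATNegOne X) (hcr : c.IsCoRay r) (z : X)
    (s : ℝ≥0) : cosh (dist z (c.1 s)) ≤
      exp (-s) * cosh (dist z (c.1 0)) + sinh s * exp (r.busemann z - r.busemann (c.1 0)) := by
  obtain ⟨σ, hσ, hlim⟩ := hcr
  refine le_of_forall_gt_imp_ge_of_dense fun b hb => ?_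
  exact le_of_tendsto ((continuous_cosh.tendsto _).comp (tendsto_const_nhds.dist (hlim s)))
    ((hX.eventually_cosh_dist_lt hσ (r.tendsto_dist_atTop _) (r.tendsto_dist_sub_dist z _) s.2
      hb).mono fun t ht => ht.le)

theorem IsCATNegOne.exp_dist_coRay_sub_le (hX : IsCATNegOne X) (hcr : c.IsCoRay r) (z : X)
    (s : ℝ≥0) : exp (dist z (c.1 s) - s) ≤
      2 * cosh (dist z (c.1 0)) * exp (-(2 * s)) + exp (r.busemann z - r.busemann (c.1 0)) :=
  exp_sub_le_of_cosh_le (hX.cosh_dist_coRay_le hcr z s) (exp_pos _).le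

theorem IsCATNegOne.busemann_coRay (hX : IsCATNegOne X) (hcr : c.IsCoRay r) (z : X) :
    c.busemann z = r.busemann z - r.busemann (c.1 0) := by
  refine le_antisymm (exp_le_exp.1 ?_) (ge_of_tendsto' (c.tendsto_busemann z) fun s => ?_)
  · have hlim := (tendsto_const_mul_exp_neg_two_mul (2 * cosh (dist z (c.1 0)))).add_const
      (exp (r.busemann z - r.busemann (c.1 0)))
    rw [zero_add] at hlim
    exact le_of_tendsto_of_tendsto' ((continuous_exp.tendsto _).comp (c.tendsto_busemann z)) hlim
      fun s => hX.exp_dist_coRay_sub_le hcr z s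
  · have hle := r.busemann_le_dist_add z (c.1 s)
    rw [hcr.busemann_apply] at hle
    linarith

theorem IsCATNegOne.endpoint_coRay (hX : IsCATNegOne X) (hcr : c.IsCoRay r) :
    c.endpoint = r.endpoint := by
  refine Quotient.sound ⟨cosh (dist (r.1 0) (c.1 0)) + exp (-r.busemann (c.1 0)), fun s => ?_⟩
  have hcosh : exp (-s) * cosh (dist (r.1 s) (c.1 0)) ≤ cosh (dist (r.1 0) (c.1 0)) := by
    have hdist : dist (r.1 s) (c.1 0) ≤ dist (r.1 0) (c.1 0) + s := by
      linarith [dist_triangle_left (r.1 s) (c.1 0) (r.1 0), r.dist_zero s]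
    rw [exp_neg, inv_mul_le_iff₀ (exp_pos _)]
    exact (cosh_dist_le_cosh hdist).trans (cosh_add_le_exp_mul_cosh _ s.2)
  have hsinh : sinh s * exp (r.busemann (r.1 s) - r.busemann (c.1 0)) ≤
      exp (-r.busemann (c.1 0)) := by
    rw [r.busemann_apply, sub_eq_add_neg, exp_add, ← mul_assoc, exp_neg]
    refine mul_le_of_le_one_left (exp_pos _).le ?_
    rw [← div_eq_mul_inv, div_le_one (exp_pos _), ← cosh_add_sinh]
    linarith [cosh_pos (s : ℝ)]
  calc dist (c.1 s) (r.1 s) = dist (r.1 s) (c.1 s) := dist_comm _ _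
    _ ≤ cosh (dist (r.1 s) (c.1 s)) :=
      (self_le_sinh_iff.2 dist_nonneg).trans (sinh_lt_cosh _).le
    _ ≤ _ := (hX.cosh_dist_coRay_le hcr (r.1 s) s).trans (add_le_add hcosh hsinh)

theorem IsCATNegOne.cauchySeq_segment (hX : IsCATNegOne X) {r : Ray X} {o : X}
    {σ : ℝ≥0 → ℝ → X} (hσ : ∀ t, IsSegment (σ t) o (r.1 t)) (s : ℝ≥0) :
    CauchySeq fun t => σ t s := by
  have hdist := r.tendsto_dist_atTop o
  have hbound : Tendsto (fun t : ℝ≥0 => exp (-s) * cosh s +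
      sinh s * exp (dist o (r.1 t) - t - s - r.busemann o)) atTop (𝓝 1) := by
    have hlim := (((continuous_exp.tendsto _).comp (((r.tendsto_busemann o).sub_const
      (s : ℝ)).sub_const (r.busemann o))).const_mul (sinh s)).const_add (exp (-s) * cosh s)
    rwa [sub_right_comm, sub_self, zero_sub, mul_comm (sinh _), ← mul_add, cosh_add_sinh,
      ← exp_add, neg_add_cancel, exp_zero] at hlim
  refine Metric.cauchySeq_iff.2 fun ε hε => ?_
  obtain ⟨t, htb, hts⟩ := ((hbound.eventually_lt_const (one_lt_cosh.2 (half_pos hε).ne')).and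
    (hdist.eventually_ge_atTop (s : ℝ))).exists
  have hs : (s : ℝ) ∈ Icc 0 (dist o (r.1 t)) := ⟨s.2, hts⟩
  have hlt : exp (-s) * cosh (dist (σ t s) o) +
      sinh s * exp (r.busemann (σ t s) - r.busemann o) < cosh (ε / 2) := by
    refine lt_of_le_of_lt ?_ htb
    rw [dist_comm, (hσ t).dist_source hs]
    gcongr
    linarith [r.busemann_le (σ t s) t, (hσ t).dist_target hs]
  obtain ⟨N, hN⟩ := eventually_atTop.1
    (hX.eventually_cosh_dist_lt hσ hdist (r.tendsto_dist_sub_dist (σ t s) o) s.2 hlt)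
  have hclose : ∀ n ≥ N, dist (σ t s) (σ n s) < ε / 2 := fun n hn =>
    dist_lt_of_cosh_dist_lt_cosh (half_pos hε).le (hN n hn)
  exact ⟨N, fun m hm n hn => by
    linarith [dist_triangle_left (σ m s) (σ n s) (σ t s), hclose m hm, hclose n hn]⟩

theorem IsCATNegOne.exists_isCoRay [CompleteSpace X] (hX : IsCATNegOne X) (r : Ray X) (o : X) :
    ∃ c : Ray X, c.1 0 = o ∧ c.IsCoRay r := by
  choose σ hσ using fun t : ℝ≥0 => hX.exists_segment o (r.1 t)
  choose c hc using fun s : ℝ≥0 =>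
    cauchySeq_tendsto_of_complete (hX.cauchySeq_segment hσ s)
  have hc_zero : c 0 = o :=
    tendsto_nhds_unique (hc 0) (tendsto_const_nhds.congr fun t => (hσ t).source.symm)
  have hc_isometry : Isometry c := by
    refine Isometry.of_dist_eq fun s s' => ?_
    refine tendsto_nhds_unique ((hc s).dist (hc s')) (tendsto_const_nhds.congr' ?_)
    have hdist := r.tendsto_dist_atTop o
    filter_upwards [hdist.eventually_ge_atTop (s : ℝ), hdist.eventually_ge_atTop (s' : ℝ)]
      with t hs hs'
    rw [(hσ t).isometric s ⟨s.2, hs⟩ s' ⟨s'.2, hs'⟩, NNReal.dist_eq]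
  exact ⟨⟨c, hc_isometry⟩, hc_zero, σ, fun t => by simpa only [hc_zero] using hσ t, hc⟩

theorem IsCATNegOne.ray_eq_of_endpoint_eq (hX : IsCATNegOne X) {c c' : Ray X}
    (hzero : c.1 0 = c'.1 0) (h : c.endpoint = c'.endpoint) : c = c' := by
  obtain ⟨C, hC⟩ : (raySetoid X).r c c' := Quotient.exact h
  refine Subtype.ext (funext fun s => eq_of_cosh_dist_le_one (sub_nonpos.1 ?_))
  have hsinh : Tendsto (fun t : ℝ≥0 => sinh t ^ 2) atTop atTop :=
    (tendsto_pow_atTop two_ne_zero).comp <| tendsto_atTop_mono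
      (fun t => self_le_sinh_iff.2 t.2) (NNReal.tendsto_coe_atTop.2 tendsto_id)
  refine ge_of_tendsto (tendsto_const_nhds.div_atTop hsinh (a := sinh s ^ 2 * (cosh C - 1))) ?_
  filter_upwards [eventually_ge_atTop s, eventually_gt_atTop 0] with t hst ht
  have hcontract := hX.sinh_sq_mul_cosh_dist_sub_one_le (c.isSegment t)
    (hzero ▸ c'.isSegment t) (s := s) (by rw [c.dist_zero, hzero, c'.dist_zero])
    ⟨s.2, by rwa [c.dist_zero, NNReal.coe_le_coe]⟩
  rw [c.dist_zero, toNNReal_coe] at hcontract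
  rw [le_div_iff₀' (pow_pos (sinh_pos_iff.2 (NNReal.coe_pos.2 ht)) 2)]
  refine hcontract.trans ?_
  gcongr
  exact cosh_dist_le_cosh (hC t)

theorem IsCATNegOne.busemann_endpoint [CompleteSpace X] (hX : IsCATNegOne X) (r : Ray X)
    (o z : X) : busemann r.endpoint o z = r.busemann z - r.busemann o := by
  obtain ⟨c, rfl, hcr⟩ := hX.exists_isCoRay r o
  have h : ∃ c' : Ray X, c'.1 0 = c.1 0 ∧ c'.endpoint = r.endpoint :=
    ⟨c, rfl, hX.endpoint_coRay hcr⟩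
  have hchoose : h.choose = c := hX.ray_eq_of_endpoint_eq h.choose_spec.1
    (h.choose_spec.2.trans (hX.endpoint_coRay hcr).symm)
  rw [← hX.busemann_coRay hcr, busemann, dif_pos h, hchoose, Ray.busemann]

theorem IsCATNegOne.continuous_busemann (hX : IsCATNegOne X) {α : Type*} [TopologicalSpace α]
    {r : α → Ray X} (hr : ∀ t, Continuous fun a => (r a).1 t) (z : X) :
    Continuous fun a => (r a).busemann z := by
  have hdist : ∀ t, Continuous fun a => dist z ((r a).1 t) := fun t => continuous_const.dist (hr t)
  have hcosh : Continuous fun a => cosh (dist z ((r a).1 0)) := continuous_cosh.comp (hdist 0)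
  -- Dividing by `cosh (dist z (r a 0))` makes the error in `exp_dist_coRay_sub_le` uniform in `a`.
  have hunif : TendstoUniformly
      (fun (t : ℝ≥0) a => exp (dist z ((r a).1 t) - t) / cosh (dist z ((r a).1 0)))
      (fun a => exp ((r a).busemann z) / cosh (dist z ((r a).1 0))) atTop := by
    refine Metric.tendstoUniformly_iff.2 fun ε hε => ?_
    filter_upwards [(tendsto_const_mul_exp_neg_two_mul 2).eventually_lt_const hε] with t ht a
    have hpos := cosh_pos (dist z ((r a).1 0))
    have hlower := exp_le_exp.2 ((r a).busemann_le z t)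
    have hupper := hX.exp_dist_coRay_sub_le (r a).isCoRay_self z t
    rw [(r a).busemann_apply, NNReal.coe_zero, neg_zero, sub_zero] at hupper
    rw [dist_comm, dist_eq_norm, ← sub_div, norm_of_nonneg (div_nonneg (sub_nonneg.2 hlower)
      hpos.le)]
    refine lt_of_le_of_lt ((div_le_iff₀ hpos).2 ?_) ht
    linarith
  have hquotient := hunif.continuous <| Frequently.of_forall fun t =>
    (continuous_exp.comp ((hdist t).sub continuous_const)).div hcosh fun a => (cosh_pos _).ne'
  have hexp : Continuous fun a => exp ((r a).busemann z) :=
    (hquotient.mul hcosh).congr fun a => div_mul_cancel₀ _ (cosh_pos _).ne'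
  exact (hexp.log fun a => (exp_pos _).ne').congr fun a => log_exp _

end CoRays

section Geodesics

/-- The geodesic `g` with the opposite parametrization, whose end at `+∞` is the end of `g` at
`-∞`. -/
def Geodesic.reverse (g : Geodesic X) : Geodesic X :=
  ⟨g.1.comp ⟨Neg.neg, continuous_neg⟩, g.2.comp (Isometry.of_dist_eq dist_neg_neg)⟩

theorem Geodesic.posEnd_reverse (g : Geodesic X) : g.reverse.posEnd = g.negEnd :=
  rfl

theorem Geodesic.continuous_reverse : Continuous (Geodesic.reverse : Geodesic X → Geodesic X) :=
  ((ContinuousMap.continuous_precomp _).comp continuous_subtype_val).subtype_mk _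

theorem Geodesic.continuous_apply (t : ℝ) : Continuous fun g : Geodesic X => g.1 t :=
  (continuous_eval_const t).comp continuous_subtype_val

theorem Geodesic.busemann_posRay (g : Geodesic X) (t : ℝ) : g.posRay.busemann (g.1 t) = -t := by
  refine tendsto_nhds_unique (g.posRay.tendsto_busemann _) (tendsto_const_nhds.congr' ?_)
  filter_upwards [eventually_ge_atTop t.toNNReal] with s hs
  have hts : t ≤ s := toNNReal_le_iff_le_coe.1 hs
  change -t = dist (g.1 t) (g.1 s) - s
  rw [g.2.dist_eq, Real.dist_eq, abs_sub_comm, abs_of_nonneg (sub_nonneg.2 hts)]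
  ring

variable [CompleteSpace X]

theorem IsCATNegOne.busemann_posEnd (hX : IsCATNegOne X) (g : Geodesic X) (o : X) (t : ℝ) :
    busemann g.posEnd o (g.1 t) = -t - g.posRay.busemann o := by
  rw [Geodesic.posEnd, hX.busemann_endpoint, g.busemann_posRay]

theorem IsCATNegOne.continuous_busemann_posEnd (hX : IsCATNegOne X) (o z : X) :
    Continuous fun g : Geodesic X => busemann g.posEnd o z := by
  have hray : ∀ w, Continuous fun g : Geodesic X => g.posRay.busemann w :=
    hX.continuous_busemann fun t => Geodesic.continuous_apply t
  exact ((hray z).sub (hray o)).congr fun g => (hX.busemann_endpoint _ _ _).symm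

theorem IsCATNegOne.continuous_busemann_posEnd_zero (hX : IsCATNegOne X) (o : X) :
    Continuous fun g : Geodesic X => busemann g.posEnd o (g.1 0) := by
  simp only [hX.busemann_posEnd, neg_zero]
  exact continuous_const.sub (hX.continuous_busemann (fun t => Geodesic.continuous_apply t) o)

end Geodesics

section BoundaryConvergence

variable {o : X} {x y : ℕ → X}

theorem tendstoBoundary_iff {ξ : IdealBoundary X} : TendstoBoundary o x ξ ↔
    ∀ z, Tendsto (fun n => dist (x n) z - dist (x n) o) atTop (𝓝 (busemann ξ o z)) := by
  refine ⟨fun h z => (h {z} isCompact_singleton).tendsto_at rfl, fun h K hK => ?_⟩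
  -- Distance functions are `1`-Lipschitz, so pointwise convergence is uniform on compact sets.
  have hequicont : UniformEquicontinuous fun n z => dist (x n) z - dist (x n) o :=
    LipschitzWith.uniformEquicontinuous _ 1 fun n => LipschitzWith.of_dist_le_mul fun z w => by
      rw [Real.dist_eq, NNReal.coe_one, one_mul, sub_sub_sub_cancel_right, dist_comm (x n) z,
        dist_comm (x n) w]
      exact abs_dist_sub_le _ _ _
  have hconv := (EquicontinuousOn.tendsto_uniformOnFun_iff_pi (𝔖 := {K : Set X | IsCompact K})
    (fun K hK => hK) (eq_univ_of_forall fun z => ⟨{z}, isCompact_singleton, rfl⟩)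
    (fun K _ => hequicont.equicontinuous.equicontinuousOn K) atTop (busemann ξ o)).2
    (tendsto_pi_nhds.2 h)
  exact UniformOnFun.tendsto_iff_tendstoUniformlyOn.1 hconv K hK

variable [CompleteSpace X] {g : Geodesic X}

theorem IsCATNegOne.tendsto_dist_sub_dist_posEnd (hX : IsCATNegOne X)
    (hx : TendstoBoundary o x g.posEnd) (t : ℝ) :
    Tendsto (fun n => dist (g.1 t) (x n) - dist (g.1 0) (x n)) atTop (𝓝 (-t)) := by
  have hlim := (tendstoBoundary_iff.1 hx (g.1 t)).sub (tendstoBoundary_iff.1 hx (g.1 0))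
  rw [hX.busemann_posEnd, hX.busemann_posEnd, sub_sub_sub_cancel_right, neg_zero, sub_zero] at hlim
  refine hlim.congr fun n => ?_
  rw [sub_sub_sub_cancel_right, dist_comm, dist_comm (x n)]

theorem IsCATNegOne.tendsto_dist_atTop_of_posEnd (hX : IsCATNegOne X)
    (hx : TendstoBoundary o x g.posEnd) : Tendsto (fun n => dist (g.1 0) (x n)) atTop atTop := by
  refine tendsto_atTop.2 fun b => ?_
  filter_upwards [(hX.tendsto_dist_sub_dist_posEnd hx (b + 1)).eventually_lt_const
    (neg_lt_neg (lt_add_one b))] with n hn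
  linarith [dist_nonneg (x := g.1 (b + 1)) (y := x n)]

theorem IsCATNegOne.tendsto_gromovProduct_of_tendstoBoundary (hX : IsCATNegOne X)
    (hx : TendstoBoundary o x g.posEnd) (hy : TendstoBoundary o y g.negEnd) :
    Tendsto (fun n => gromovProduct (g.1 0) (x n) (y n)) atTop (𝓝 0) := by
  rw [← g.posEnd_reverse] at hy
  have hzero : g.reverse.1 0 = g.1 0 := congrArg g.1 neg_zero
  choose σ hσ using fun n => hX.exists_segment (g.1 0) (y n)
  have hy_dist := hX.tendsto_dist_atTop_of_posEnd hy
  have hy_sub := hX.tendsto_dist_sub_dist_posEnd hy 1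
  rw [hzero] at hy_dist hy_sub
  have hunit : dist (g.reverse.1 1) (g.1 0) = 1 := by
    rw [← hzero, g.reverse.2.dist_eq, Real.dist_eq, sub_zero, abs_one]
  have hσ_lim : Tendsto (fun n => σ n 1) atTop (𝓝 (g.reverse.1 1)) :=
    hX.tendsto_segment_apply hσ hy_dist hunit hy_sub
  have hx_sub := (tendsto_dist_sub_dist_zero hσ_lim x).add
    (hX.tendsto_dist_sub_dist_posEnd hx (-1))
  have hx_dist := hX.tendsto_dist_atTop_of_posEnd hx
  refine hX.tendsto_gromovProduct_zero one_pos hσ ?_ hy_dist ?_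
  · simpa only [dist_comm] using hx_dist
  · rw [neg_neg, zero_add] at hx_sub
    refine hx_sub.congr fun n => ?_
    rw [dist_comm (x n), dist_comm (x n)]
    exact sub_add_sub_cancel _ _ _

theorem IsCATNegOne.tendsto_midpoint_of_tendstoGeodesic (hX : IsCATNegOne X) {u : ℕ → X × X}
    (hu : TendstoGeodesic o u g) {m : ℕ → X} (hm : ∀ n, IsApproxMidpoint 0 (u n) (m n)) :
    Tendsto m atTop (𝓝 (g.1 0)) := by
  obtain ⟨hpos, hneg, hsub⟩ := hu
  have hdiff : Tendsto (fun n => dist (u n).1 (g.1 0) - dist (u n).2 (g.1 0)) atTop (𝓝 0) := by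
    have h := ((tendstoBoundary_iff.1 hpos (g.1 0)).sub
      (tendstoBoundary_iff.1 hneg (g.1 0))).add hsub
    rw [sub_add_sub_cancel, sub_self] at h
    exact h.congr fun n => by ring
  have herror := (hdiff.abs.div_const 2).add (hX.tendsto_gromovProduct_of_tendstoBoundary hpos hneg)
  rw [abs_zero, zero_div, zero_add] at herror
  exact hX.tendsto_midpoint hm (fun n => isApproxMidpoint_gromovProduct (u n) (g.1 0)) herror

end BoundaryConvergence

section ExtendedSpace

variable {Y : Type*}

/-- The function on `X × X ∪ G` given by `f` on `X × X` and by `h` on `G`. -/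
def Extended.elim (f : X × X → Y) (h : Geodesic X → Y) : Extended X → Y
  | Extended.pt p => f p
  | Extended.geod g => h g

theorem Extended.pt_injective : Function.Injective (Extended.pt : X × X → Extended X) :=
  fun _ _ h => by injection h

theorem Extended.geod_injective : Function.Injective (Extended.geod : Geodesic X → Extended X) :=
  fun _ _ h => by injection h

variable (o : X)

theorem isOpenEmbedding_pt :
    @IsOpenEmbedding _ _ _ (extendedTopology o) (Extended.pt : X × X → Extended X) := by
  let _ := extendedTopology o
  refine IsOpenEmbedding.of_continuous_injective_isOpenMap
    (continuous_def.2 fun V hV => hV.1) Extended.pt_injective fun V hV => ⟨?_, ?_, ?_⟩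
  · rwa [preimage_image_eq _ Extended.pt_injective]
  · convert isOpen_empty
    ext g
    simp
  · rintro u g ⟨p, -, hp⟩
    cases hp

theorem isClosedEmbedding_geod :
    @IsClosedEmbedding _ _ _ (extendedTopology o) (Extended.geod : Geodesic X → Extended X) := by
  let _ := extendedTopology o
  refine IsClosedEmbedding.of_continuous_injective_isClosedMap
    (continuous_def.2 fun V hV => hV.2.1) Extended.geod_injective fun C hC => ⟨⟨?_, ?_, ?_⟩⟩
  · convert isOpen_univ
    ext p
    simp
  · rw [preimage_compl, preimage_image_eq _ Extended.geod_injective]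
    exact hC.isOpen_compl
  · refine fun u g _ _ => Eventually.of_forall fun n => ?_
    rintro ⟨g', -, hg'⟩
    cases hg'

variable [TopologicalSpace Y]

theorem continuous_of_tendstoGeodesic {F : Extended X → Y}
    (hpt : Continuous fun p => F (Extended.pt p)) (hgeod : Continuous fun g => F (Extended.geod g))
    (hlim : ∀ (u : ℕ → X × X) (g : Geodesic X), TendstoGeodesic o u g →
      Tendsto (fun n => F (Extended.pt (u n))) atTop (𝓝 (F (Extended.geod g)))) :
    @Continuous _ _ (extendedTopology o) _ F := by
  let _ := extendedTopology o
  refine continuous_def.2 fun V hV => ⟨hV.preimage hpt, hV.preimage hgeod, fun u g hg hu => ?_⟩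
  exact (hlim u g hu).eventually (hV.mem_nhds hg)

theorem tendsto_of_tendsto_pt {f : X × X → Y} {h : Geodesic X → Y} (hf : Continuous f)
    (hh : Continuous h) (hlim : ∀ (u : ℕ → X × X) (g : Geodesic X), TendstoGeodesic o u g →
      Tendsto (fun n => f (u n)) atTop (𝓝 (h g))) {u : ℕ → X × X} {g : Geodesic X}
    (hu : Tendsto (fun n => Extended.pt (u n)) atTop
      (@nhds _ (extendedTopology o) (Extended.geod g))) :
    Tendsto (fun n => f (u n)) atTop (𝓝 (h g)) := by
  let _ := extendedTopology o
  have hcont : Continuous (Extended.elim f h) := continuous_of_tendstoGeodesic o hf hh hlim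
  exact (hcont.tendsto _).comp hu

variable [CompleteSpace X]

theorem IsCATNegOne.tendsto_pt_iff (hX : IsCATNegOne X) (u : ℕ → X × X) (g : Geodesic X) :
    Tendsto (fun n => Extended.pt (u n)) atTop (@nhds _ (extendedTopology o) (Extended.geod g)) ↔
      TendstoGeodesic o u g := by
  let _ := extendedTopology o
  refine ⟨fun hu => ⟨?_, ?_, ?_⟩, fun hu => tendsto_nhds.2 fun V hV hg => hV.2.2 u g hg hu⟩
  · exact tendstoBoundary_iff.2 fun z => tendsto_of_tendsto_pt o
      (f := fun p => dist p.1 z - dist p.1 o) (by fun_prop)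
      (hX.continuous_busemann_posEnd o z) (fun _ _ h => tendstoBoundary_iff.1 h.1 z) hu
  · exact tendstoBoundary_iff.2 fun z => tendsto_of_tendsto_pt o
      (f := fun p => dist p.2 z - dist p.2 o) (by fun_prop)
      ((hX.continuous_busemann_posEnd o z).comp Geodesic.continuous_reverse)
      (fun _ _ h => tendstoBoundary_iff.1 h.2.1 z) hu
  · have hneg := (hX.continuous_busemann_posEnd_zero o).comp Geodesic.continuous_reverse
    have hzero : ∀ g : Geodesic X, g.reverse.1 0 = g.1 0 := fun g => congrArg g.1 neg_zero
    simp only [Function.comp_def, hzero] at hneg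
    exact tendsto_of_tendsto_pt o (f := fun p => dist p.1 o - dist p.2 o) (by fun_prop)
      (hneg.sub (hX.continuous_busemann_posEnd_zero o)) (fun _ _ h => h.2.2) hu

theorem IsCATNegOne.continuous_extendRetraction (hX : IsCATNegOne X) {ρ : X × X → diagonal X}
    (hρ : ∀ p, IsNearestPoint p (ρ p)) :
    @Continuous _ _ (extendedTopology o) _ (extendRetraction ρ) := by
  let _ := extendedTopology o
  have hmid : ∀ p, IsApproxMidpoint 0 p (ρ p).1.1 := fun p => (hX.isNearestPoint_iff p _).1 (hρ p)
  have hfst : Continuous fun e => (extendRetraction ρ e).1.1 :=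
    continuous_of_tendstoGeodesic o (hX.continuous_midpoint hmid) (Geodesic.continuous_apply 0)
      fun u g hu => hX.tendsto_midpoint_of_tendstoGeodesic hu fun n => hmid (u n)
  refine continuous_induced_rng.2 ((hfst.prodMk hfst).congr fun e => ?_)
  exact Prod.ext rfl (extendRetraction ρ e).2

end ExtendedSpace

end MaxCompactification

open MaxCompactification in
theorem mainTheorem7_general {X : Type*} [MetricSpace X] [CompleteSpace X]
    (hX : IsCATNegOne X) (o : X) :
    (@IsOpenEmbedding _ _ _ (extendedTopology o) (Extended.pt : X × X → Extended X) ∧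
      @IsClosedEmbedding _ _ _ (extendedTopology o) (Extended.geod : Geodesic X → Extended X) ∧
      ∀ (u : ℕ → X × X) (g : Geodesic X),
        Tendsto (fun n => Extended.pt (u n)) atTop
            (@nhds _ (extendedTopology o) (Extended.geod g)) ↔
          TendstoGeodesic o u g) ∧
    (∀ p : X × X, ∃! q : Set.diagonal X, IsNearestPoint p q) ∧
    ∀ ρ : X × X → Set.diagonal X, (∀ p, IsNearestPoint p (ρ p)) →
      @Continuous _ _ (extendedTopology o) _ (extendRetraction ρ) :=
  ⟨⟨isOpenEmbedding_pt o, isClosedEmbedding_geod o, hX.tendsto_pt_iff o⟩,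
    hX.existsUnique_isNearestPoint, fun _ hρ => hX.continuous_extendRetraction o hρ⟩

theorem mainTheorem7 {X : Type*} [MetricSpace X] [ProperSpace X] [NoncompactSpace X]
    (hX : MaxCompactification.IsCATNegOne X) (o : X) :
    -- the topology of `X × X ∪ G` induces the given ones on `X × X` and `G`,
    -- and has the prescribed convergence of sequences of `X × X` to points of `G`
    (@Topology.IsOpenEmbedding _ _ _ (MaxCompactification.extendedTopology o)
        (MaxCompactification.Extended.pt : X × X → MaxCompactification.Extended X) ∧
      @Topology.IsClosedEmbedding _ _ _ (MaxCompactification.extendedTopology o)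
        (MaxCompactification.Extended.geod :
          MaxCompactification.Geodesic X → MaxCompactification.Extended X) ∧
      ∀ (u : ℕ → X × X) (g : MaxCompactification.Geodesic X),
        Filter.Tendsto (fun n => MaxCompactification.Extended.pt (u n)) Filter.atTop
            (@nhds _ (MaxCompactification.extendedTopology o)
              (MaxCompactification.Extended.geod g)) ↔
          MaxCompactification.TendstoGeodesic o u g) ∧
    -- every point of `X × X` has exactly one nearest point in the diagonal
    (∀ p : X × X, ∃! q : Set.diagonal X, MaxCompactification.IsNearestPoint p q) ∧
    -- the extension of the nearest point retraction is continuous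
    ∀ ρ : X × X → Set.diagonal X, (∀ p, MaxCompactification.IsNearestPoint p (ρ p)) →
      @Continuous _ _ (MaxCompactification.extendedTopology o) _
        (MaxCompactification.extendRetraction ρ) :=
  mainTheorem7_general hX o
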